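/- Let $n\ge 2$, $f\ge 1$, $\mu\ge f$ be integers and $\mathbb{F}_q$ a finite field. Let $W^{(1)},\dots,W^{(f)}$ be $f$ independent messages, each a vector of $\beta L\ge 1$ independent symbols uniformly distributed over $\mathbb{F}_q$. Let $\phi^{(1)},\dots,\phi^{(\mu)}:\mathbb{F}_q^f\to\mathbb{F}_q$ be candidate functions with images $\mathbf X^{(v)}=(X^{(v)}_1,\dots,X^{(v)}_{\beta L})$, $X^{(v)}_i=\phi^{(v)}(W^{(1)}_i,\dots,W^{(f)}_i)$, and let $(X^{(1)},\dots,X^{(\mu)})$ be distributed as $(X^{(1)}_i,\dots,X^{(\mu)}_i)$ (the distribution is the same for all $i$). Entropies $H$ are in $q$-ary units, $H_{\min}=\min_v H(X^{(v)})$, $X^{[v]}=(X^{(1)},\dots,X^{(v)})$ and $H(X^{[0]})=0$. Suppose that the images of the candidate functions include the $f$ messages $W^{(1)},\dots,W^{(f)}$. Then the candidate functions can be listed in descending order of entropy, $H(X^{(1)})\ge\dots\ge H(X^{(\mu)})$, with ties broken such that the $f$ messages occupy (in some order) the first $f$ places; and for every such listing the outer bound on the private computation capacity for $n$ noncolluding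 replicated databases satisfies $$\frac{n^{\mu}H_{\min}}{\sum_{v=1}^{\mu} n^{\mu-v+1}\bigl[H(X^{[v]})-H(X^{[v-1]})\bigr]}=H_{\min}\,\frac{1-\frac1n}{1-\left(\frac1n\right)^f}=H_{\min}\,C_{\mathrm{PIR}},$$ where $C_{\mathrm{PIR}}:=\frac{1-1/n}{1-(1/n)^f}$ is the expression known to be the private information retrieval capacity for $n$ noncolluding replicated databases storing $f$ messages. -/

import Mathlib

open MeasureTheory ProbabilityTheory

noncomputable section

namespace PrivateComputation

/-- Shannon entropy, in `q`-ary units, of a random variable `Y` with finitely many values. -/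
def entropy {Ω S : Type*} [MeasurableSpace Ω] (P : Measure Ω) [Fintype S] (q : ℕ)
    (Y : Ω → S) : ℝ :=
  (∑ y : S, Real.negMulLog (P.real (Y ⁻¹' {y}))) / Real.log q

/-- The joint random variable formed by the first `k` members of the tuple `X`
(for `k = 0` it is the empty tuple, for `k = μ` the whole tuple). -/
def firstVars {Ω F : Type*} {μ : ℕ} (X : Fin μ → Ω → F) (k : ℕ) :
    Ω → ({u : Fin μ // u.val < k} → F) :=
  fun ω u => X u.1 ω

/-- The smallest entropy among the members of the tuple `X`, in `|F|`-ary units. -/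
def minEntropy {Ω F : Type*} [MeasurableSpace Ω] (P : Measure Ω) [Fintype F] {μ : ℕ}
    (X : Fin μ → Ω → F) : ℝ :=
  ⨅ v : Fin μ, entropy P (Fintype.card F) (X v)

/-- The outer bound
`n ^ μ * Hmin / ∑_{v = 1}^{μ} n ^ (μ - v + 1) * (H(X^[v]) - H(X^[v-1]))`
on the private computation capacity with `n` databases, for the (ordered) tuple `X` of prototype
random variables of the candidate functions. The index `v` of the sum is shifted by one,
since `Fin μ` starts at `0`. -/
def outerBound {Ω F : Type*} [MeasurableSpace Ω] (P : Measure Ω) [Fintype F] (n : ℕ) {μ : ℕ}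
    (X : Fin μ → Ω → F) : ℝ :=
  (n : ℝ) ^ μ * minEntropy P X /
    ∑ v : Fin μ, (n : ℝ) ^ (μ - v.val) *
      (entropy P (Fintype.card F) (firstVars X (v.val + 1))
        - entropy P (Fintype.card F) (firstVars X v.val))

/-- The private information retrieval capacity `(1 - 1/n) / (1 - (1/n)^f)` for `n` noncolluding
replicated databases storing `f` messages. -/
def pirCapacity (n f : ℕ) : ℝ :=
  (1 - 1 / (n : ℝ)) / (1 - (1 / (n : ℝ)) ^ f)

/-- `W` consists of `f` independent random messages of length `N`, with independent symbols that
are uniformly distributed over the finite alphabet `F`. -/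
structure IsUniformMessages {Ω F : Type*} [MeasurableSpace Ω] (P : Measure Ω) [Fintype F]
    [MeasurableSpace F] {f N : ℕ} (W : Fin f → Ω → (Fin N → F)) : Prop where
  measurable : ∀ m i, Measurable (fun ω => W m ω i)
  indep : iIndepFun (fun (p : Fin f × Fin N) (ω : Ω) => W p.1 ω p.2) P
  uniform : ∀ m i (x : F), P.real {ω | W m ω i = x} = 1 / (Fintype.card F : ℝ)

/-- The image of the candidate function `φ v`: the random vector whose `i`-th symbol
is `φ v` applied to the `i`-th symbols of the `f` messages. -/
def image {Ω F : Type*} {f μ N : ℕ} (φ : Fin μ → (Fin f → F) → F)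
    (W : Fin f → Ω → (Fin N → F)) (v : Fin μ) : Ω → (Fin N → F) :=
  fun ω i => φ v (fun m => W m ω i)

/-- The `i`-th symbols of the images of all candidate functions; for each `i` this
tuple is a copy of the tuple of prototype random variables `X^(1), …, X^(μ)`. -/
def prototype {Ω F : Type*} {f μ N : ℕ} (φ : Fin μ → (Fin f → F) → F)
    (W : Fin f → Ω → (Fin N → F)) (i : Fin N) (v : Fin μ) : Ω → F :=
  fun ω => image φ W v ω i

/-- The listing `φ` of the candidate functions is in descending order of entropy, and the ties are
broken so that the `f` messages are listed (in some order) at the first `f` places. -/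
structure IsOrdered {Ω F : Type*} [MeasurableSpace Ω] (P : Measure Ω) [Fintype F] {f μ N : ℕ}
    (φ : Fin μ → (Fin f → F) → F) (W : Fin f → Ω → (Fin N → F)) : Prop where
  descending : ∀ i, Antitone (fun v => entropy P (Fintype.card F) (prototype φ W i v))
  messages_first : ∀ m, ∃ v : Fin μ, v.val < f ∧ image φ W v = W m

end PrivateComputation

end

/-! A message symbol is uniform on the alphabet, so it has entropy 1, the maximum for an image
symbol. Sorting by entropy can therefore place the `f` messages first. In such a listing the first
`k ≤ f` variables are independent and uniform, with joint entropy `k`; once all messages are listed,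
the remaining images are functions of them and add nothing. So `H(X^[k]) = min k f`
(`IsOrdered.entropy_firstVars`), the increments are 1 for the first `f` places and 0 afterwards, and
the denominator is a geometric sum (`sum_pow_mul_min_diff`). Reordering leaves the minimum entropy
unchanged. -/

namespace PrivateComputation

/-! ### Shannon entropy of finite-valued variables -/

section Entropy

variable {Ω S T : Type*} [MeasurableSpace Ω] {P : Measure Ω} [Fintype S] [Fintype T]

/-- A random variable that is uniform on a finite set `S` has entropy `log |S|`. -/
theorem entropy_of_uniform [Nonempty S] (q : ℕ) (Y : Ω → S)
    (hY : ∀ y, P.real (Y ⁻¹' {y}) = 1 / (Fintype.card S : ℝ)) :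
    entropy P q Y = Real.log (Fintype.card S) / Real.log q := by
  have hS : (Fintype.card S : ℝ) ≠ 0 := by exact_mod_cast Fintype.card_ne_zero
  simp only [entropy, hY, Finset.sum_const, Finset.card_univ, nsmul_eq_mul, Real.negMulLog,
    one_div, Real.log_inv]
  field_simp

/-- Entropy is at most the logarithm of the number of values. -/
theorem entropy_le_log_card [MeasurableSpace S] [MeasurableSingletonClass S]
    [IsProbabilityMeasure P] [Nonempty S] (q : ℕ) {Y : Ω → S} (hY : Measurable Y) :
    entropy P q Y ≤ Real.log (Fintype.card S) / Real.log q := by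
  have hS : (Fintype.card S : ℝ) ≠ 0 := by exact_mod_cast Fintype.card_ne_zero
  have hsum : ∑ y : S, P.real (Y ⁻¹' {y}) = 1 := by
    rw [sum_measureReal_preimage_singleton _ fun y _ => hY (measurableSet_singleton y)]
    simp
  refine div_le_div_of_nonneg_right ?_ (Real.log_natCast_nonneg q)
  -- Jensen with equal weights, the points being the probabilities, whose mean is `1 / |S|`.
  have h := Real.concaveOn_negMulLog.le_map_sum (t := Finset.univ)
    (w := fun _ : S => 1 / (Fintype.card S : ℝ)) (p := fun y : S => P.real (Y ⁻¹' {y}))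
    (fun _ _ => by positivity) (by simp [hS]) (fun _ _ => measureReal_nonneg)
  simp only [smul_eq_mul, ← Finset.mul_sum, hsum, mul_one] at h
  have h' : Real.negMulLog (1 / (Fintype.card S : ℝ))
      = 1 / (Fintype.card S : ℝ) * Real.log (Fintype.card S) := by
    simp [Real.negMulLog]
  rw [h'] at h
  exact le_of_mul_le_mul_left h (by positivity)

/-- Entropy does not change under an injective relabelling of the values. -/
theorem entropy_comp_of_injective (q : ℕ) (Y : Ω → S) {g : S → T}
    (hg : Function.Injective g) :
    entropy P q (fun ω => g (Y ω)) = entropy P q Y := by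
  unfold entropy
  congr 1
  symm
  -- Values outside the range of `g` have probability 0 and contribute `negMulLog 0 = 0`.
  refine Finset.sum_of_injOn g hg.injOn (fun _ _ => Finset.mem_coe.2 (Finset.mem_univ _)) ?_ ?_
  · intro t _ ht
    have : (fun ω => g (Y ω)) ⁻¹' {t} = ∅ := by
      ext ω
      simp only [Set.mem_preimage, Set.mem_singleton_iff, Set.mem_empty_iff_false, iff_false]
      rintro rfl
      exact ht ⟨Y ω, by simp, rfl⟩
    simp [this]
  · intro s _
    congr 2
    ext ω
    simp [hg.eq_iff]

end Entropy

/-! ### Sorting with prescribed tie-breaking -/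

/-- If a function is maximal on a set `s`, the indices can be sorted in descending order
of its values such that the elements of `s` come first. -/
theorem exists_perm_antitone_of_max {μ : ℕ} (s : Finset (Fin μ)) (h : Fin μ → ℝ)
    (hs : ∀ a ∈ s, ∀ b, h b ≤ h a) :
    ∃ σ : Equiv.Perm (Fin μ), Antitone (fun v => h (σ v)) ∧
      ∀ a ∈ s, (σ.symm a).val < s.card := by
  -- Lexicographic key: membership in `s` decides first, then descending `h`.
  let key : Fin μ → ℕ ×ₗ ℝ := fun v => toLex (if v ∈ s then 0 else 1, -h v)
  have hmono : Monotone (key ∘ Tuple.sort key) := Tuple.monotone_sort key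
  have hlex : ∀ v w, v ≤ w →
      ((if Tuple.sort key v ∈ s then 0 else 1 : ℕ) < (if Tuple.sort key w ∈ s then 0 else 1) ∨
      ((if Tuple.sort key v ∈ s then 0 else 1 : ℕ) = (if Tuple.sort key w ∈ s then 0 else 1) ∧
        -h (Tuple.sort key v) ≤ -h (Tuple.sort key w))) := fun v w hvw =>
    Prod.Lex.toLex_le_toLex.1 (hmono hvw)
  refine ⟨Tuple.sort key, fun v w hvw => ?_, fun a ha => ?_⟩
  · by_cases hv : Tuple.sort key v ∈ s
    · exact hs _ hv _
    · rcases hlex v w hvw with h1 | ⟨-, h2⟩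
      · rw [if_neg hv] at h1
        split_ifs at h1 <;> omega
      · exact neg_le_neg_iff.1 h2
  · have hsub : (Finset.Iic ((Tuple.sort key).symm a)).map (Tuple.sort key).toEmbedding ⊆ s := by
      intro b hb
      obtain ⟨v, hv, rfl⟩ := Finset.mem_map.1 hb
      have h1 := hlex v _ (Finset.mem_Iic.1 hv)
      rw [Equiv.apply_symm_apply, if_pos ha] at h1
      by_contra hb'
      rw [Equiv.coe_toEmbedding] at hb'
      rw [if_neg hb'] at h1
      omega
    have := Finset.card_le_card hsub
    rw [Finset.card_map, Fin.card_Iic] at this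
    omega

/-! ### Independent uniform messages and ordered listings -/

section Messages

variable {Ω F : Type*} [MeasurableSpace Ω] {P : Measure Ω} [Fintype F]
  [MeasurableSpace F] [MeasurableSingletonClass F] {f N : ℕ} {W : Fin f → Ω → (Fin N → F)}

/-- The `i`-th symbols of distinct messages are jointly uniform. -/
theorem IsUniformMessages.real_preimage_singleton (hW : IsUniformMessages P W) (i : Fin N)
    {ι : Type*} [Fintype ι] [DecidableEq ι] {g : ι → Fin f} (hg : Function.Injective g)
    (y : ι → F) :
    P.real ((fun ω j => W (g j) ω i) ⁻¹' {y}) = 1 / (Fintype.card (ι → F) : ℝ) := by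
  have hind : iIndepFun (fun (j : ι) (ω : Ω) => W (g j) ω i) P :=
    hW.indep.precomp (g := fun j => (g j, i)) fun a b hab => hg (Prod.ext_iff.1 hab).1
  have hset : (fun ω j => W (g j) ω i) ⁻¹' {y}
      = ⋂ j ∈ (Finset.univ : Finset ι), (fun ω => W (g j) ω i) ⁻¹' {y j} := by
    ext ω
    simp [funext_iff]
  rw [hset, measureReal_def,
    hind.measure_inter_preimage_eq_mul Finset.univ fun j _ => measurableSet_singleton (y j),
    ENNReal.toReal_prod]
  have : ∀ j, (P ((fun ω => W (g j) ω i) ⁻¹' {y j})).toReal = 1 / (Fintype.card F : ℝ) :=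
    fun j => hW.uniform (g j) i (y j)
  simp [this]

theorem IsUniformMessages.entropy_joint [Nontrivial F] (hW : IsUniformMessages P W) (i : Fin N)
    {ι : Type*} [Fintype ι] [DecidableEq ι] {g : ι → Fin f} (hg : Function.Injective g) :
    entropy P (Fintype.card F) (fun ω j => W (g j) ω i) = Fintype.card ι := by
  rw [entropy_of_uniform _ _ (hW.real_preimage_singleton i hg)]
  have : Real.log (Fintype.card F) ≠ 0 :=
    (Real.log_pos (by exact_mod_cast Fintype.one_lt_card)).ne'
  simp [Real.log_pow, this]

theorem IsUniformMessages.measurable_symbols (hW : IsUniformMessages P W) (i : Fin N) :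
    Measurable (fun ω m => W m ω i) :=
  measurable_pi_lambda _ fun m => hW.measurable m i

/-- Distinct messages are distinct random variables. -/
theorem IsUniformMessages.injective [IsProbabilityMeasure P] [Nontrivial F]
    (hW : IsUniformMessages P W) (i : Fin N) : Function.Injective W := by
  intro a b hab
  by_contra hne
  obtain ⟨x, y, hxy⟩ := exists_pair_ne F
  -- This tuple separates `a` from `b`: it has positive probability, yet `W a = W b` makes it
  -- impossible.
  have h := hW.real_preimage_singleton i Function.injective_id (fun m => if m = a then x else y)
  have hempty : (fun ω m => W (id m) ω i) ⁻¹' {fun m => if m = a then x else y} = ∅ := by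
    ext ω
    simp only [Set.mem_preimage, Set.mem_singleton_iff, Set.mem_empty_iff_false, iff_false]
    intro hω
    have h1 := congrFun hω a
    have h2 := congrFun hω b
    simp only [id, if_true, if_neg (Ne.symm hne)] at h1 h2
    exact hxy (by rw [← h1, ← h2, hab])
  rw [hempty, measureReal_empty] at h
  have : (0 : ℝ) < 1 / (Fintype.card (Fin f → F) : ℝ) := by
    have : 0 < Fintype.card (Fin f → F) := Fintype.card_pos
    positivity
  linarith

/-- The entropies of the prototype variables do not depend on the symbol index. -/
theorem IsUniformMessages.entropy_prototype_eq [IsProbabilityMeasure P]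
    (hW : IsUniformMessages P W) {μ : ℕ} (φ : Fin μ → (Fin f → F) → F) (i j : Fin N)
    (v : Fin μ) :
    entropy P (Fintype.card F) (prototype φ W i v)
      = entropy P (Fintype.card F) (prototype φ W j v) := by
  classical
  -- For every symbol index the law is the pushforward under `φ v` of the uniform law on `Fin f →
  -- F`.
  have hreal : ∀ k : Fin N, ∀ x : F, P.real (prototype φ W k v ⁻¹' {x})
      = ∑ z ∈ Finset.univ.filter (fun z => φ v z = x), 1 / (Fintype.card (Fin f → F) : ℝ) := by
    intro k x
    have hsum := sum_measureReal_preimage_singleton (μ := P)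
      (Finset.univ.filter (fun z => φ v z = x)) (f := fun ω m => W m ω k)
      fun z _ => hW.measurable_symbols k (measurableSet_singleton z)
    have hset : (fun ω m => W m ω k) ⁻¹' ↑(Finset.univ.filter (fun z => φ v z = x))
        = prototype φ W k v ⁻¹' {x} := by
      ext ω
      simp [prototype, image]
    rw [← hset, ← hsum]
    exact Finset.sum_congr rfl fun z _ =>
      hW.real_preimage_singleton k Function.injective_id z
  simp only [entropy, hreal]

/-- Makes the messages entropy maximizers, which is what allows them to be listed first. -/
theorem IsUniformMessages.entropy_prototype_le_one [IsProbabilityMeasure P] [Nontrivial F]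
    (hW : IsUniformMessages P W) {μ : ℕ} (φ : Fin μ → (Fin f → F) → F) (i : Fin N)
    (v : Fin μ) : entropy P (Fintype.card F) (prototype φ W i v) ≤ 1 := by
  have hm : Measurable (prototype φ W i v) :=
    (measurable_of_finite (φ v)).comp (hW.measurable_symbols i)
  refine (entropy_le_log_card _ hm).trans_eq (div_self ?_)
  exact (Real.log_pos (by exact_mod_cast Fintype.one_lt_card)).ne'

theorem IsUniformMessages.entropy_prototype_message [Nontrivial F]
    (hW : IsUniformMessages P W) {μ : ℕ} {φ : Fin μ → (Fin f → F) → F} (i : Fin N)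
    {v : Fin μ} {m : Fin f} (h : image φ W v = W m) :
    entropy P (Fintype.card F) (prototype φ W i v) = 1 := by
  have hp : prototype φ W i v = fun ω => W m ω i := by
    funext ω
    simp [prototype, h]
  have hS : Real.log (Fintype.card F) ≠ 0 :=
    (Real.log_pos (by exact_mod_cast Fintype.one_lt_card)).ne'
  rw [hp, entropy_of_uniform _ _ fun y => hW.uniform m i y, div_self hS]

/-- If the images include the messages, they can be listed in descending order of entropy
with the messages first. -/
theorem IsUniformMessages.exists_isOrdered [IsProbabilityMeasure P] [Nontrivial F]
    (hW : IsUniformMessages P W) (i : Fin N) {μ : ℕ} {φ : Fin μ → (Fin f → F) → F}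
    (hφ : ∀ m, ∃ v, image φ W v = W m) :
    ∃ σ : Equiv.Perm (Fin μ), IsOrdered P (φ ∘ σ) W := by
  choose c hc using hφ
  obtain ⟨σ, hanti, hfirst⟩ := exists_perm_antitone_of_max (Finset.univ.image c)
    (fun v => entropy P (Fintype.card F) (prototype φ W i v)) (by
      intro a ha b
      obtain ⟨m, -, rfl⟩ := Finset.mem_image.1 ha
      rw [hW.entropy_prototype_message i (hc m)]
      exact hW.entropy_prototype_le_one φ i b)
  refine ⟨σ, fun j v w hvw => ?_, fun m => ⟨σ.symm (c m), ?_, ?_⟩⟩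
  · have h := hanti hvw
    simp only [hW.entropy_prototype_eq φ i j] at h
    exact h
  · refine (hfirst (c m) (Finset.mem_image_of_mem c (Finset.mem_univ m))).trans_le ?_
    exact Finset.card_image_le.trans_eq (by simp)
  · rw [← hc m]
    funext ω k
    simp [image]

/-- In an ordered listing each of the first `f` places is taken by a different message. -/
theorem IsOrdered.exists_messageEquiv [IsProbabilityMeasure P] [Nontrivial F]
    (hW : IsUniformMessages P W) (i : Fin N) {μ : ℕ} {φ : Fin μ → (Fin f → F) → F}
    (hφ : IsOrdered P φ W) (hμ : f ≤ μ) :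
    ∃ π : Equiv.Perm (Fin f), ∀ k : Fin f, image φ W (Fin.castLE hμ k) = W (π k) := by
  choose c hlt hc using hφ.messages_first
  -- Pigeonhole: `f` distinct messages in `f` places fill each place exactly once.
  have hinj : Function.Injective (fun m => (⟨(c m).val, hlt m⟩ : Fin f)) := by
    intro a b hab
    have : c a = c b := Fin.ext (Fin.mk.inj_iff.1 hab)
    exact hW.injective i (by rw [← hc a, ← hc b, this])
  let e : Equiv.Perm (Fin f) := Equiv.ofBijective _ (Finite.injective_iff_bijective.1 hinj)
  refine ⟨e.symm, fun k => ?_⟩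
  rw [← hc]
  congr 1
  have := e.apply_symm_apply k
  exact Fin.ext (congrArg Fin.val this).symm

/-- In an ordered listing, the joint entropy of the first `k` prototype variables is
`min k f`. -/
theorem IsOrdered.entropy_firstVars [IsProbabilityMeasure P] [Nontrivial F]
    (hW : IsUniformMessages P W) (i : Fin N) {μ : ℕ} {φ : Fin μ → (Fin f → F) → F}
    (hφ : IsOrdered P φ W) (hμ : f ≤ μ) {k : ℕ} (hk : k ≤ μ) :
    entropy P (Fintype.card F) (firstVars (prototype φ W i) k) = (min k f : ℕ) := by
  obtain ⟨π, hπ⟩ := hφ.exists_messageEquiv hW i hμ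
  have hproto : ∀ (m : Fin f) (ω : Ω),
      prototype φ W i (Fin.castLE hμ m) ω = W (π m) ω i := fun m ω => by
    simp [prototype, hπ]
  rcases le_total k f with hkf | hfk
  · have hlt : ∀ u : {u : Fin μ // u.val < k}, u.1.val < f := fun u => u.2.trans_le hkf
    have hfun : firstVars (prototype φ W i) k
        = fun ω (u : {u : Fin μ // u.val < k}) => W (π ⟨u.1.val, hlt u⟩) ω i := by
      funext ω u
      exact hproto ⟨u.1.val, hlt u⟩ ω
    rw [hfun, hW.entropy_joint i (g := fun u : {u : Fin μ // u.val < k} => π ⟨u.1.val, hlt u⟩)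
      (fun a b hab => Subtype.ext (Fin.ext (Fin.mk.inj_iff.1 (π.injective hab)))),
      min_eq_left hkf, Fintype.card_congr (Fin.castLEquiv hk).symm, Fintype.card_fin]
  -- All messages are among the first `k` variables, so `g` merely relabels the message tuple.
  · let g : (Fin f → F) → ({u : Fin μ // u.val < k} → F) := fun z u => φ u.1 z
    have hfun : firstVars (prototype φ W i) k = fun ω => g (fun m => W m ω i) := rfl
    -- every tuple of symbols is attained, so `g` is injective on all of `Fin f → F`
    have hrange : ∀ z : Fin f → F, ∃ ω, (fun m => W m ω i) = z := by
      intro z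
      by_contra! hz
      have h := hW.real_preimage_singleton i Function.injective_id z
      have hempty : (fun ω m => W (id m) ω i) ⁻¹' {z} = ∅ :=
        Set.eq_empty_of_forall_notMem hz
      rw [hempty, measureReal_empty] at h
      have hpos : 0 < Fintype.card (Fin f → F) := Fintype.card_pos
      have : (0 : ℝ) < 1 / (Fintype.card (Fin f → F) : ℝ) := by positivity
      linarith
    have hg : Function.Injective g := by
      intro z z' hzz
      obtain ⟨ω, rfl⟩ := hrange z
      obtain ⟨ω', rfl⟩ := hrange z'
      funext m
      have h := congrFun hzz ⟨Fin.castLE hμ (π.symm m), (π.symm m).isLt.trans_le hfk⟩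
      have h1 := hproto (π.symm m) ω
      have h2 := hproto (π.symm m) ω'
      rw [Equiv.apply_symm_apply] at h1 h2
      rw [← h1, ← h2]
      exact h
    rw [hfun, entropy_comp_of_injective _ _ hg,
      hW.entropy_joint i (g := fun m => m) Function.injective_id, min_eq_right hfk,
      Fintype.card_fin]

end Messages

/-! ### The geometric sum and the conclusion -/

/-- If the joint entropies are those of `f` messages listed first, the denominator of the
outer bound is a geometric sum. -/
theorem sum_pow_mul_min_diff {n f μ : ℕ} (hn : 2 ≤ n) (hμ : f ≤ μ) :
    ∑ v : Fin μ, (n : ℝ) ^ (μ - v.val) * (((min (v.val + 1) f : ℕ) : ℝ) - (min v.val f : ℕ))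
      = (n : ℝ) ^ μ * ((1 - (1 / (n : ℝ)) ^ f) / (1 - 1 / (n : ℝ))) := by
  have hn0 : (n : ℝ) ≠ 0 := by positivity
  have hn1 : 1 / (n : ℝ) ≠ 1 := by
    rw [one_div, Ne, inv_eq_one]
    exact_mod_cast (by omega : n ≠ 1)
  rw [Fin.sum_univ_eq_sum_range (fun v : ℕ => (n : ℝ) ^ (μ - v) *
    (((min (v + 1) f : ℕ) : ℝ) - (min v f : ℕ))) μ]
  -- From index `f` on both minima equal `f`, so the terms vanish.
  rw [← Finset.sum_subset (Finset.range_subset_range.2 hμ) (fun v _ hv => by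
    have : f ≤ v := by simpa using hv
    simp [min_eq_right this, min_eq_right (this.trans v.le_succ)])]
  have hgeom := geom_sum_eq hn1 f
  rw [← neg_sub ((1 / (n : ℝ)) ^ f) 1, ← neg_sub (1 / (n : ℝ)) 1, neg_div_neg_eq, ← hgeom,
    Finset.mul_sum]
  refine Finset.sum_congr rfl fun v hv => ?_
  have hvf : v < f := Finset.mem_range.1 hv
  rw [min_eq_left (Nat.succ_le_of_lt hvf), min_eq_left hvf.le, pow_sub₀ _ hn0 (by omega)]
  simp

theorem minEntropy_prototype_comp_perm {Ω F : Type*} [MeasurableSpace Ω] (P : Measure Ω)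
    [Fintype F] {f μ N : ℕ} (φ : Fin μ → (Fin f → F) → F) (W : Fin f → Ω → (Fin N → F))
    (σ : Equiv.Perm (Fin μ)) (i : Fin N) :
    minEntropy P (prototype (φ ∘ σ) W i) = minEntropy P (prototype φ W i) :=
  σ.iInf_comp (g := fun v => entropy P (Fintype.card F) (prototype φ W i v))

end PrivateComputation

theorem corollary1 {Ω F : Type*} [MeasurableSpace Ω] (P : Measure Ω) [IsProbabilityMeasure P]
    [Field F] [Fintype F] [MeasurableSpace F] [MeasurableSingletonClass F]
    (n f μ β L : ℕ) (hn : 2 ≤ n) (hf : 1 ≤ f) (hμ : f ≤ μ)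
    (W : Fin f → Ω → (Fin (β * L) → F)) (hβL : 1 ≤ β * L)
    (hW : PrivateComputation.IsUniformMessages P W)
    (φ : Fin μ → (Fin f → F) → F)
    (hφ : ∀ m : Fin f, ∃ v : Fin μ, PrivateComputation.image φ W v = W m) :
    (∃ σ : Equiv.Perm (Fin μ), PrivateComputation.IsOrdered P (φ ∘ σ) W) ∧
    ∀ σ : Equiv.Perm (Fin μ), PrivateComputation.IsOrdered P (φ ∘ σ) W →
      ∀ i : Fin (β * L),
        PrivateComputation.outerBound P n (PrivateComputation.prototype (φ ∘ σ) W i)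
          = PrivateComputation.minEntropy P (PrivateComputation.prototype φ W i)
              * PrivateComputation.pirCapacity n f := by
  have i₀ : Fin (β * L) := ⟨0, hβL⟩
  refine ⟨hW.exists_isOrdered i₀ hφ, fun σ hσ i => ?_⟩
  have hn0 : (n : ℝ) ^ μ ≠ 0 := by positivity
  unfold PrivateComputation.outerBound PrivateComputation.pirCapacity
  rw [PrivateComputation.minEntropy_prototype_comp_perm]
  simp only [fun v : Fin μ => hσ.entropy_firstVars hW i hμ (Nat.succ_le_of_lt v.isLt),
    fun v : Fin μ => hσ.entropy_firstVars hW i hμ v.isLt.le]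
  rw [PrivateComputation.sum_pow_mul_min_diff hn hμ, mul_div_mul_left _ _ hn0, div_div_eq_mul_div,
    mul_div_assoc]
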